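/- Let $(K,v)$ be a non-trivially valued field with value group $\Gamma_K$ (written additively, $v(0)=+\infty$). For $a\in K$ and $\gamma\in\Gamma_K$ write $B(a,\gamma)=\{x\in K: v(x-a)\ge\gamma\}$. A ball is a set $\{x: v(x-a)\ge\gamma\}$ with $\gamma\in\Gamma_K\cup\{+\infty\}$ or a set $\{x: v(x-a)>\gamma\}$ with $\gamma\in\Gamma_K\cup\{-\infty\}$. Let $\mathcal L$ be a language extending $\mathcal L_{div}=(+,-,\cdot,0,1,\mathrm{div})$, where $\mathrm{div}(x,y)$ means $v(x)\le v(y)$, and let $(K,\mathcal L)$ be an expansion of $(K,\mathcal L_{div})$ which is $C$-minimal: for every structure $(K',\mathcal L)$ elementarily equivalent to $(K,\mathcal L)$, every $\mathcal L$-definable subset of $K'$ is a Boolean combination of balls. "Definable" means $\mathcal L$-definable with parameters; a subset of $K^m\times\Gamma_K^k$ is called definable if its preimage in $K^m\times(K^\times)^k$ under $v$ (applied to the last $k$ coordinates) is definable; a function is definable if its graph is. A neighborhood of infinity is a set $K\setminus B(0,\gamma)$ with $\gamma\in\Gamma_K$; a function is defined at a neighborhood of infinity if its domain contains one. (1) Let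 $f\colon X\subseteq K\to K^\times$ be a definable function defined at a neighborhood of infinity. Then there are a definable function $h\colon\Gamma_K\to\Gamma_K$ and $\gamma_0\in\Gamma_K$ such that $v(f(x))=h(v(x))$ for all $x\in X\setminus B(0,\gamma_0)$. (2) Let $W\subseteq K^n$ be a definable set, let $X\subseteq W\times K$ be a definable set whose projection to $K^n$ is $W$, and let $f\colon X\to K^\times$ be a definable function such that for every $w\in W$ the function $f_w\colon X_w\to K^\times$, $f_w(x)=f(w,x)$, where $X_w=\{x\in K:(w,x)\in X\}$, is defined at a neighborhood of infinity. Then there is a definable function $h\colon W\times\Gamma_K\to\Gamma_K$ such that for every $w\in W$ there is $\gamma_0\in\Gamma_K$ with $v(f_w(x))=h(w,v(x))$ for all $x\in X_w\setminus B(0,\gamma_0)$. -/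

import Mathlib

namespace CMin

open FirstOrder FirstOrder.Language FirstOrder.Language.Structure FirstOrder.Ring

universe u

/-- The single binary relation symbol `div` added to the language of rings. -/
inductive DivRel : ℕ → Type
  | div : DivRel 2

/-- The language of valued fields `(+, -, ·, 0, 1, div)`. -/
def Ldiv : Language := Language.ring.sum ⟨fun _ => Empty, DivRel⟩

section Symbols

variable {L : Language} (φ : Ldiv →ᴸ L) {N : Type*} [L.Structure N]

/-- The interpretation of `+` in an `L`-structure, where `L` extends `Ldiv` through `φ`. -/
def opAdd (x y : N) : N := funMap (φ.onFunction (Sum.inl addFunc : Ldiv.Functions 2)) ![x, y]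

/-- The interpretation of `·`. -/
def opMul (x y : N) : N := funMap (φ.onFunction (Sum.inl mulFunc : Ldiv.Functions 2)) ![x, y]

/-- The interpretation of (unary) `-`. -/
def opNeg (x : N) : N := funMap (φ.onFunction (Sum.inl negFunc : Ldiv.Functions 1)) ![x]

/-- The interpretation of `0`. -/
def opZero : N := funMap (φ.onFunction (Sum.inl zeroFunc : Ldiv.Functions 0)) ![]

/-- The interpretation of `1`. -/
def opOne : N := funMap (φ.onFunction (Sum.inl oneFunc : Ldiv.Functions 0)) ![]

/-- The interpretation of `div`; in a valued field, `relDiv φ x y` means `v x ≤ v y`. -/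
def relDiv (x y : N) : Prop :=
  RelMap (φ.onRelation (Sum.inr DivRel.div : Ldiv.Relations 2)) ![x, y]

/-- The balls of an `L`-structure that is (elementarily equivalent to) an expansion of a valued
field. As every element of the value group is some `v b` with `b ≠ 0`, and `v 0 = +∞`, the closed
balls `{x | v (x - a) ≥ γ}` with `γ ∈ Γ ∪ {+∞}` are the sets `{x | v b ≤ v (x - a)}`, and the open
balls `{x | v (x - a) > γ}` with `γ ∈ Γ ∪ {-∞}` are the sets `{x | v (x - a) > v b}` with `b ≠ 0`,
together with the whole structure. -/
inductive IsBall : Set N → Prop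
  | closedBall (a b : N) : IsBall {x | relDiv φ b (opAdd φ x (opNeg φ a))}
  | openBall (a b : N) (hb : b ≠ opZero φ) :
      IsBall {x | ¬ relDiv φ (opAdd φ x (opNeg φ a)) b}
  | univ : IsBall Set.univ

end Symbols

/-- The `L`-structure on `K` expands the valued field `(K, v)` in the language `Ldiv`,
where `L` extends `Ldiv` through `φ`. -/
structure ExpandsValuedField {L : Language} (φ : Ldiv →ᴸ L) {K Γ : Type*} [Field K]
    [L.Structure K] [AddCommGroup Γ] [LinearOrder Γ] [IsOrderedAddMonoid Γ]
    (v : AddValuation K (WithTop Γ)) : Prop where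
  add : ∀ x y : K, opAdd φ x y = x + y
  mul : ∀ x y : K, opMul φ x y = x * y
  neg : ∀ x : K, opNeg φ x = -x
  zero : (opZero φ : K) = 0
  one : (opOne φ : K) = 1
  div : ∀ x y : K, relDiv φ x y ↔ v x ≤ v y

/-- `C`-minimality: in every elementarily equivalent structure, every subset definable with
parameters is a Boolean combination of balls. (By Löwenheim-Skolem it makes no difference to
restrict to structures in the universe of `K`.) -/
def CMinimal {L : Language} (φ : Ldiv →ᴸ L) (K : Type u) [L.Structure K] : Prop :=
  ∀ (N : Type u) [L.Structure N], L.ElementarilyEquivalent K N →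
    ∀ X : Set N, (Set.univ : Set N).Definable₁ L X →
      X ∈ BooleanSubalgebra.closure {s : Set N | IsBall φ s}

section Gamma

variable {K Γ : Type*} [Field K] [AddCommGroup Γ] [LinearOrder Γ] [IsOrderedAddMonoid Γ]

/-- Definability (with parameters) of a subset `S` of `K^α × Γ^β`, where `Γ` is interpreted as the
quotient of `Kˣ` by `v x = v y`: the preimage of `S` in `K^α × (Kˣ)^β` is definable. -/
def GammaDefinable (L : Language) [L.Structure K] (v : AddValuation K (WithTop Γ))
    {α β : Type} (S : Set ((α → K) × (β → Γ))) : Prop :=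
  (Set.univ : Set K).Definable L
    {z : α ⊕ β → K | ∃ g : β → Γ, (∀ i, v (z (Sum.inr i)) = (g i : WithTop Γ)) ∧
      (fun i => z (Sum.inl i), g) ∈ S}

/-- The closed ball `B(a, γ)`. -/
def ball (v : AddValuation K (WithTop Γ)) (a : K) (γ : Γ) : Set K :=
  {x | (γ : WithTop Γ) ≤ v (x - a)}

/-- `X` contains a neighborhood of infinity. -/
def ContainsNhdInfty (v : AddValuation K (WithTop Γ)) (X : Set K) : Prop :=
  ∃ γ : Γ, (ball v 0 γ)ᶜ ⊆ X

/-- The function `f : X → K` factorizes at infinity over `Γ` through `h`. Here `WithTop.map h`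
extends `h` by `+∞ ↦ +∞`; that value is never used, since `0` lies in every ball `B(0, γ₀)`. -/
def FactorizesAtInftyThrough (v : AddValuation K (WithTop Γ)) {X : Set K} (f : X → K)
    (h : Γ → Γ) : Prop :=
  ∃ γ₀ : Γ, ∀ x : X, (x : K) ∉ ball v 0 γ₀ → v (f x) = WithTop.map h (v (x : K))

end Gamma

section Families

variable {K : Type*} {n : ℕ}

/-- A subset of `K^n × K` is definable (with parameters). -/
def DefinableFamily (L : Language) [L.Structure K] (X : Set ((Fin n → K) × K)) : Prop :=
  (Set.univ : Set K).Definable L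
    {z : Fin n ⊕ Unit → K | (fun i => z (Sum.inl i), z (Sum.inr ())) ∈ X}

/-- A function `f : X → K` with `X ⊆ K^n × K` is definable (with parameters), i.e. its graph is. -/
def DefinableFamilyFun (L : Language) [L.Structure K] {X : Set ((Fin n → K) × K)}
    (f : X → K) : Prop :=
  (Set.univ : Set K).Definable L
    {z : Fin n ⊕ Fin 2 → K | ∃ hz : (fun i => z (Sum.inl i), z (Sum.inr 0)) ∈ X,
      f ⟨_, hz⟩ = z (Sum.inr 1)}

/-- The fiber `X_w`. -/
def fiber (X : Set ((Fin n → K) × K)) (w : Fin n → K) : Set K := {x | (w, x) ∈ X}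

/-- The function `f_w : X_w → K`. -/
def fiberFun {X : Set ((Fin n → K) × K)} (f : X → K) (w : Fin n → K) (x : fiber X w) : K :=
  f ⟨(w, (x : K)), x.2⟩

end Families

end CMin

/-! Everything reduces to one claim: for a definable `F : K → K`, the value `v (F x)` depends only
on `v x` once `v x` is small enough (`exists_val_comp_eq`). The function `h` can then be read off on
each set `v x = γ`, uniformly in parameters, although the bound `γ₀` depends on them.

Three consequences of C-minimality carry the claim. A definable subset of `K` contains or misses a
neighborhood of infinity (`eventually_mem_or_notMem`). The residue field is infinite
(`infinite_residueField`). The fibers of a definable family cannot separate long sequences that are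
equidistant in a common ball, with a bound `N` on the length that is uniform in the parameters
(`exists_not_separates`).

For units `u j` with distinct residues, the comparison of `v (F x)` with `v (F (u j * x))` has a
constant outcome near infinity, and infinitely many `j` share the same outcome. If it is `<` or `>`,
the points `u j * x` and `(u j)⁻¹ * x` lie on opposite sides of the condition `v (F x) < v (F z)` on
`z`, which contradicts the bound `N`. If it is `=` and `v (F x) < v (F y)` with `v x = v y`, the
same condition separates the `u j * y` from the `u j * x`. -/

namespace CMin

open FirstOrder FirstOrder.Language FirstOrder.Language.Structure FirstOrder.Ring

universe u

/-! ### Closure properties of definable predicates and terms -/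

section Definability

variable {L : Language} {K : Type*} [L.Structure K] {α β : Type}

/-- A predicate on tuples is definable with parameters. -/
def DefPred (L : Language) [L.Structure K] (P : (α → K) → Prop) : Prop :=
  (Set.univ : Set K).Definable L {z | P z}

/-- A function on tuples is given by a term with parameters. -/
def TermFun (L : Language) [L.Structure K] (g : (α → K) → K) : Prop :=
  ∃ t : L[[(Set.univ : Set K)]].Term α, ∀ z, t.realize z = g z

theorem DefPred.congr {P Q : (α → K) → Prop} (h : DefPred L P) (hPQ : ∀ z, Q z ↔ P z) :
    DefPred L Q := by
  have : {z | Q z} = {z | P z} := Set.ext hPQ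
  unfold DefPred
  rwa [this]

theorem DefPred.not {P : (α → K) → Prop} (h : DefPred L P) : DefPred L fun z => ¬ P z :=
  h.compl

theorem DefPred.and {P Q : (α → K) → Prop} (h : DefPred L P) (h' : DefPred L Q) :
    DefPred L fun z => P z ∧ Q z :=
  h.inter h'

theorem DefPred.or {P Q : (α → K) → Prop} (h : DefPred L P) (h' : DefPred L Q) :
    DefPred L fun z => P z ∨ Q z :=
  h.union h'

theorem DefPred.imp {P Q : (α → K) → Prop} (h : DefPred L P) (h' : DefPred L Q) :
    DefPred L fun z => P z → Q z :=
  (h.not.or h').congr fun _ => imp_iff_not_or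

theorem DefPred.exists {P : (α → K) → K → Prop}
    (h : DefPred L fun z : α ⊕ Fin 1 → K => P (fun i => z (.inl i)) (z (.inr 0))) :
    DefPred L fun z => ∃ x, P z x := by
  have := Set.Definable.image_comp_sumInl_fin 1 h
  refine DefPred.congr (P := fun z : α → K => z ∈ (fun g : α ⊕ Fin 1 → K => g ∘ Sum.inl) ''
    {z | P (fun i => z (.inl i)) (z (.inr 0))}) this fun z => ?_
  constructor
  · rintro ⟨x, hx⟩
    exact ⟨Sum.elim z fun _ => x, hx, rfl⟩
  · rintro ⟨y, hy, rfl⟩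
    exact ⟨y (.inr 0), hy⟩

theorem DefPred.forall {P : (α → K) → K → Prop}
    (h : DefPred L fun z : α ⊕ Fin 1 → K => P (fun i => z (.inl i)) (z (.inr 0))) :
    DefPred L fun z => ∀ x, P z x :=
  (DefPred.exists (P := fun z x => ¬ P z x) h.not).not.congr fun _ => by simp

theorem DefPred.subst {P : (α → K) → Prop} (h : DefPred L P) {g : α → (β → K) → K}
    (hg : ∀ i, TermFun L (g i)) : DefPred L fun z => P fun i => g i z := by
  obtain ⟨ψ, hψ⟩ := h
  choose t ht using hg
  refine ⟨ψ.subst t, ?_⟩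
  ext z
  have : (fun i => (t i).realize z) = fun i => g i z := funext fun i => ht i z
  have h2 : P (fun i => g i z) ↔ ψ.Realize (fun i => g i z) := by
    exact Set.ext_iff.1 hψ _
  simp only [Set.mem_ofPred_eq, h2, Formula.Realize, BoundedFormula.realize_subst, this]

theorem TermFun.congr {f g : (α → K) → K} (h : TermFun L f) (hfg : ∀ z, g z = f z) :
    TermFun L g := by
  rwa [funext hfg]

theorem TermFun.var (i : α) : TermFun L fun z : α → K => z i :=
  ⟨Term.var i, fun _ => rfl⟩

theorem TermFun.const (c : K) : TermFun L fun _ : α → K => c :=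
  ⟨(L.con (⟨c, trivial⟩ : (Set.univ : Set K))).term, fun z => by
    simp [Term.realize_constants]⟩

theorem DefPred.reindex {P : (α → K) → Prop} (h : DefPred L P) (ρ : α → β) :
    DefPred L fun z => P fun i => z (ρ i) :=
  h.subst fun i => TermFun.var (ρ i)

theorem TermFun.func {n : ℕ} (f : L.Functions n) {g : Fin n → (α → K) → K}
    (hg : ∀ i, TermFun L (g i)) : TermFun L fun z => funMap f fun i => g i z := by
  choose t ht using hg
  refine ⟨Term.func (Sum.inl f : L[[(Set.univ : Set K)]].Functions n) t, fun z => ?_⟩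
  simp only [Term.realize, ht]
  rfl

theorem DefPred.rel {n : ℕ} (r : L.Relations n) {g : Fin n → (α → K) → K}
    (hg : ∀ i, TermFun L (g i)) : DefPred L fun z => RelMap r fun i => g i z := by
  have : DefPred L fun z : Fin n → K => RelMap r z :=
    ⟨Relations.formula (Sum.inl r : L[[(Set.univ : Set K)]].Relations n) Term.var, by
      ext z
      simp only [Set.mem_ofPred_eq]
      rfl⟩
  exact this.subst hg

theorem DefPred.eq {s t : (α → K) → K} (hs : TermFun L s) (ht : TermFun L t) :
    DefPred L fun z => s z = t z := by
  obtain ⟨a, ha⟩ := hs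
  obtain ⟨b, hb⟩ := ht
  refine ⟨a.equal b, ?_⟩
  ext z
  simp [Formula.realize_equal, ha, hb]

theorem TermFun.subst {f : (α → K) → K} (hf : TermFun L f) {g : α → (β → K) → K}
    (hg : ∀ i, TermFun L (g i)) : TermFun L fun z => f fun i => g i z := by
  obtain ⟨s, hs⟩ := hf
  choose t ht using hg
  exact ⟨s.subst t, fun z => by simp [Term.realize_subst, ht, hs]⟩

end Definability

/-! ### Definability of field operations and comparison of valuations -/

section ValuedField

variable {L : Language} {φ : Ldiv →ᴸ L} {K Γ : Type*} [Field K] [L.Structure K]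
  [AddCommGroup Γ] [LinearOrder Γ] [IsOrderedAddMonoid Γ] {v : AddValuation K (WithTop Γ)}
  {α : Type}

namespace ExpandsValuedField

theorem termFun_add (hφ : ExpandsValuedField φ v) {s t : (α → K) → K}
    (hs : TermFun L s) (ht : TermFun L t) : TermFun L fun z => s z + t z := by
  refine (TermFun.func (φ.onFunction (Sum.inl addFunc : Ldiv.Functions 2)) (g := ![s, t])
    (by intro i; fin_cases i <;> assumption)).congr fun z => (hφ.add _ _).symm.trans ?_
  refine congrArg (funMap _) (funext fun i => ?_)
  fin_cases i <;> rfl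

theorem termFun_mul (hφ : ExpandsValuedField φ v) {s t : (α → K) → K}
    (hs : TermFun L s) (ht : TermFun L t) : TermFun L fun z => s z * t z := by
  refine (TermFun.func (φ.onFunction (Sum.inl mulFunc : Ldiv.Functions 2)) (g := ![s, t])
    (by intro i; fin_cases i <;> assumption)).congr fun z => (hφ.mul _ _).symm.trans ?_
  refine congrArg (funMap _) (funext fun i => ?_)
  fin_cases i <;> rfl

theorem termFun_pow (hφ : ExpandsValuedField φ v) {s : (α → K) → K}
    (hs : TermFun L s) (n : ℕ) : TermFun L fun z => s z ^ n := by
  induction n with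
  | zero => simpa using TermFun.const 1
  | succ n ih => simpa only [pow_succ] using hφ.termFun_mul ih hs

theorem defPred_le (hφ : ExpandsValuedField φ v) {s t : (α → K) → K}
    (hs : TermFun L s) (ht : TermFun L t) : DefPred L fun z => v (s z) ≤ v (t z) := by
  have := DefPred.rel (φ.onRelation (Sum.inr DivRel.div : Ldiv.Relations 2)) (g := ![s, t])
    (by intro i; fin_cases i <;> assumption)
  refine this.congr fun z => ?_
  rw [← hφ.div, relDiv]
  have : (![s z, t z] : Fin 2 → K) = fun i => (![s, t] : Fin 2 → (α → K) → K) i z := by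
    ext i
    fin_cases i <;> rfl
  rw [this]

theorem defPred_lt (hφ : ExpandsValuedField φ v) {s t : (α → K) → K}
    (hs : TermFun L s) (ht : TermFun L t) : DefPred L fun z => v (s z) < v (t z) :=
  (hφ.defPred_le ht hs).not.congr fun _ => not_le.symm

theorem defPred_val_eq (hφ : ExpandsValuedField φ v) {s t : (α → K) → K}
    (hs : TermFun L s) (ht : TermFun L t) : DefPred L fun z => v (s z) = v (t z) :=
  ((hφ.defPred_le hs ht).and (hφ.defPred_le ht hs)).congr fun _ => le_antisymm_iff

end ExpandsValuedField

end ValuedField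

/-! ### Boolean combinations of balls along two sequences -/

section BooleanCombinations

open Filter

theorem mem_boolean_closure_induction {N : Type*} {B : Set (Set N)} {Q : Set N → Prop}
    (hB : ∀ s ∈ B, Q s) (h0 : Q ∅) (hc : ∀ s, Q s → Q sᶜ) (hu : ∀ s t, Q s → Q t → Q (s ∪ t))
    {X : Set N} (hX : X ∈ BooleanSubalgebra.closure B) : Q X := by
  induction hX using BooleanSubalgebra.closure_bot_sup_induction with
  | mem s hs => exact hB s hs
  | bot => exact h0
  | sup s hs t ht h h' => exact hu s t h h'
  | compl s hs h => exact hc s h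

/-- If every set of `B` with two points on one of the two sequences contains both sequences, then
every Boolean combination of members of `B` eventually contains both or misses both. -/
theorem eventually_mem_or_notMem_of_mem_closure {N : Type*} {B : Set (Set N)} {a b : ℕ → N}
    (ha : ∀ s ∈ B, ∀ i j, i ≠ j → a i ∈ s → a j ∈ s → ∀ k, a k ∈ s ∧ b k ∈ s)
    (hb : ∀ s ∈ B, ∀ i j, i ≠ j → b i ∈ s → b j ∈ s → ∀ k, a k ∈ s ∧ b k ∈ s)
    {X : Set N} (hX : X ∈ BooleanSubalgebra.closure B) :
    (∀ᶠ j in atTop, a j ∈ X ∧ b j ∈ X) ∨ (∀ᶠ j in atTop, a j ∉ X ∧ b j ∉ X) := by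
  refine mem_boolean_closure_induction (Q := fun X => (∀ᶠ j in atTop, a j ∈ X ∧ b j ∈ X) ∨
    (∀ᶠ j in atTop, a j ∉ X ∧ b j ∉ X)) (fun s hs => ?_) (.inr (.of_forall fun _ => ⟨id, id⟩))
    (fun s h => ?_) (fun s t h h' => ?_) hX
  · by_cases h : ∀ k, a k ∈ s ∧ b k ∈ s
    · exact .inl (.of_forall h)
    -- A set of `B` that does not contain both sequences holds at most one term of each.
    · have key : ∀ c : ℕ → N, (∀ i j, i ≠ j → c i ∈ s → c j ∈ s → ∀ k, a k ∈ s ∧ b k ∈ s) →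
          ∀ᶠ j in atTop, c j ∉ s := by
        intro c hc
        by_contra hf
        rw [not_eventually] at hf
        simp only [not_not, frequently_atTop] at hf
        obtain ⟨i, -, hi⟩ := hf 0
        obtain ⟨j, hj, hj'⟩ := hf (i + 1)
        exact h (hc i j (by omega) hi hj')
      exact .inr ((key a (ha s hs)).and (key b (hb s hs)))
  · rcases h with h | h
    · exact .inr (h.mono fun j hj => ⟨fun h => h hj.1, fun h => h hj.2⟩)
    · exact .inl h
  · rcases h with h | h
    · exact .inl (h.mono fun j hj => ⟨.inl hj.1, .inl hj.2⟩)
    rcases h' with h' | h'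
    · exact .inl (h'.mono fun j hj => ⟨.inr hj.1, .inr hj.2⟩)
    · refine .inr ((h.and h').mono fun j hj => ⟨?_, ?_⟩)
      · rintro (h | h)
        exacts [hj.1.1 h, hj.2.1 h]
      · rintro (h | h)
        exacts [hj.1.2 h, hj.2.2 h]

end BooleanCombinations

/-! ### Operations in an ultrapower -/

section Ultrapower

open Filter

variable {L : Language} {φ : Ldiv →ᴸ L} {K : Type u} [L.Structure K] {U : Ultrafilter ℕ}

/-- The class of a sequence in the ultrapower. -/
def ultraMk (U : Ultrafilter ℕ) (x : ℕ → K) : (U : Filter ℕ).Product fun _ => K :=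
  (x : (U : Filter ℕ).Product fun _ => K)

theorem funMap_ultraMk {n : ℕ} (f : L.Functions n) (x : Fin n → ℕ → K) :
    (funMap f fun i => ultraMk U (x i)) = ultraMk U fun m => funMap f fun i => x i m :=
  Ultraproduct.funMap_cast f x

theorem opAdd_ultraMk (x y : ℕ → K) :
    opAdd φ (ultraMk U x) (ultraMk U y) = ultraMk U fun n => opAdd φ (x n) (y n) := by
  have := funMap_ultraMk (U := U) (φ.onFunction (Sum.inl addFunc : Ldiv.Functions 2)) ![x, y]
  unfold opAdd
  convert this using 2
  · ext i
    fin_cases i <;> rfl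
  · ext n
    refine congrArg _ (funext fun i => ?_)
    fin_cases i <;> rfl

theorem opNeg_ultraMk (x : ℕ → K) :
    opNeg φ (ultraMk U x) = ultraMk U fun n => opNeg φ (x n) := by
  have := funMap_ultraMk (U := U) (φ.onFunction (Sum.inl negFunc : Ldiv.Functions 1)) ![x]
  unfold opNeg
  convert this using 2
  · ext i
    fin_cases i
    rfl
  · ext n
    refine congrArg _ (funext fun i => ?_)
    fin_cases i
    rfl

end Ultrapower

/-! ### Uniform bound on separation, by an ultrapower argument -/

section Separation

open Filter

variable {L : Language} {φ : Ldiv →ᴸ L} {K : Type u} {Γ : Type*} [Field K] [L.Structure K]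
  [AddCommGroup Γ] [LinearOrder Γ] [IsOrderedAddMonoid Γ] {v : AddValuation K (WithTop Γ)}
  {U : Ultrafilter ℕ}

theorem ExpandsValuedField.opSub_ultraMk (hφ : ExpandsValuedField φ v) (x a : ℕ → K) :
    opAdd φ (ultraMk U x) (opNeg φ (ultraMk U a)) = ultraMk U fun n => x n - a n := by
  rw [opNeg_ultraMk, opAdd_ultraMk]
  simp only [hφ.add, hφ.neg, sub_eq_add_neg]

theorem ExpandsValuedField.relDiv_ultraMk (hφ : ExpandsValuedField φ v) (x y : ℕ → K) :
    relDiv φ (ultraMk U x) (ultraMk U y) ↔ ∀ᶠ n in U, v (x n) ≤ v (y n) := by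
  have := relMap_quotient_mk' (s := (U : Filter ℕ).productSetoid fun _ => K)
    (φ.onRelation (Sum.inr DivRel.div : Ldiv.Relations 2)) ![x, y]
  have h3 : (![ultraMk U x, ultraMk U y] : Fin 2 → _) =
      fun i => ultraMk U ((![x, y] : Fin 2 → ℕ → K) i) := by
    ext i
    fin_cases i <;> rfl
  rw [relDiv, h3]
  refine Iff.trans this (eventually_congr (.of_forall fun n => ?_))
  rw [← hφ.div, relDiv]
  refine iff_of_eq (congrArg _ (funext fun i => ?_))
  fin_cases i <;> rfl

/-- By the ultrametric inequality, a ball containing two points contains every point at least as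
close to one of them as they are to each other. The argument is carried out coordinatewise, so the
ultrapower needs no valuation of its own. -/
theorem ExpandsValuedField.mem_of_isBall_ultrapower (hφ : ExpandsValuedField φ v)
    {s : Set ((U : Filter ℕ).Product fun _ => K)} (hs : IsBall φ s) {x y z : ℕ → K}
    (hx : ultraMk U x ∈ s) (hy : ultraMk U y ∈ s)
    (h : ∀ᶠ n in U, v (x n - y n) ≤ v (z n - x n)) : ultraMk U z ∈ s := by
  have hv : ∀ x y z a : K, v (x - y) ≤ v (z - x) →
      min (v (x - a)) (v (y - a)) ≤ v (z - a) := by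
    intro x y z a h
    have h1 : min (v (x - a)) (v (y - a)) ≤ v (x - y) := by
      have := v.map_sub (x - a) (y - a)
      rwa [sub_sub_sub_cancel_right] at this
    have := v.map_add (z - x) (x - a)
    rw [sub_add_sub_cancel] at this
    exact (le_min (h1.trans h) (min_le_left _ _)).trans this
  have hrep : ∀ a : (U : Filter ℕ).Product fun _ => K,
      ∃ a' : ℕ → K, a = ultraMk U a' := fun a =>
    (Quotient.exists_rep a).imp fun _ h => h.symm
  cases hs with
  | closedBall a b =>
    obtain ⟨a, rfl⟩ := hrep a
    obtain ⟨b, rfl⟩ := hrep b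
    rw [Set.mem_ofPred_eq, hφ.opSub_ultraMk, hφ.relDiv_ultraMk] at hx hy ⊢
    filter_upwards [hx, hy, h] with n h1 h2 h3
    exact (le_min h1 h2).trans (hv _ _ _ _ h3)
  | openBall a b hb =>
    obtain ⟨a, rfl⟩ := hrep a
    obtain ⟨b, rfl⟩ := hrep b
    have key : ∀ x : ℕ → K,
        ¬ relDiv φ (opAdd φ (ultraMk U x) (opNeg φ (ultraMk U a))) (ultraMk U b) ↔
        ∀ᶠ n in U, v (b n) < v (x n - a n) := by
      intro x
      rw [hφ.opSub_ultraMk, hφ.relDiv_ultraMk, ← Ultrafilter.eventually_not]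
      simp only [not_le]
    rw [Set.mem_ofPred_eq, key] at hx hy ⊢
    filter_upwards [hx, hy, h] with n h1 h2 h3
    exact (lt_min h1 h2).trans_le (hv _ _ _ _ h3)
  | univ => trivial

/-- In a `C`-minimal valued field, the fibers of a definable family cannot separate arbitrarily long
finite sequences which lie in one closed ball and whose members are pairwise at the distance given
by the radius of that ball. -/
theorem ExpandsValuedField.exists_not_separates (hφ : ExpandsValuedField φ v)
    (hC : CMinimal φ K) {α : Type} {P : (α ⊕ Unit → K) → Prop} (hP : DefPred L P) :
    ∃ N : ℕ, ∀ (w : α → K) (γ : WithTop Γ) (a b : ℕ → K),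
      (∀ i < N, ∀ j < N, i ≠ j → v (a i - a j) = γ) →
      (∀ i < N, ∀ j < N, i ≠ j → v (b i - b j) = γ) →
      (∀ i < N, ∀ j < N, γ ≤ v (a i - b j)) →
      (∀ i < N, P (Sum.elim w fun _ => a i)) →
      ¬ ∀ i < N, ¬ P (Sum.elim w fun _ => b i) := by
  by_contra hcon
  push Not at hcon
  -- For each `n` there is a separated pair of sequences of length `n`. In a nonprincipal ultrapower
  -- they become two infinite sequences, `j ↦ [a n j]` and `j ↦ [b n j]`, separated by the single
  -- definable set `S` with parameters `[w n]`; a ball with two terms of either sequence contains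
  -- both.
  choose w γ a b haa hbb hab ha hb using hcon
  let U : Ultrafilter ℕ := hyperfilter ℕ
  have hU : ∀ m, ∀ᶠ n in (U : Filter ℕ), m < n := fun m =>
    Nat.hyperfilter_le_atTop (eventually_gt_atTop m)
  obtain ⟨ψ, hψ⟩ := Set.definable_iff_exists_formula_sum.1 hP
  have hψ' : ∀ z, P z ↔ ψ.Realize (Sum.elim (fun c : (Set.univ : Set K) => (c : K)) z) :=
    fun z => Set.ext_iff.1 hψ z
  let val : (Set.univ : Set K) ⊕ (α ⊕ Unit) → (ℕ → K) → ℕ → K := fun i x =>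
    Sum.elim (fun (c : (Set.univ : Set K)) _ => (c : K)) (Sum.elim (fun i n => w n i) fun _ => x) i
  let S : Set ((U : Filter ℕ).Product fun _ => K) :=
    {x | ψ.Realize (Sum.elim (fun c : (Set.univ : Set K) => ultraMk U fun _ => (c : K))
      (Sum.elim (fun i => ultraMk U fun n => w n i) fun _ => x))}
  have hS : ∀ x, ultraMk U x ∈ S ↔ ∀ᶠ n in U, P (Sum.elim (w n) fun _ => x n) := by
    intro x
    have := Ultraproduct.realize_formula_cast (M := fun _ : ℕ => K) (u := U) ψ (val · x)
    have e1 : (Sum.elim (fun c : (Set.univ : Set K) => ultraMk U fun _ => (c : K))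
        (Sum.elim (fun i => ultraMk U fun n => w n i) fun _ : Unit => ultraMk U x)) =
        fun i => ultraMk U (val i x) := by
      ext i
      rcases i with c | i | i <;> rfl
    have e2 : ∀ n, (Sum.elim (fun c : (Set.univ : Set K) => (c : K))
        (Sum.elim (w n) fun _ => x n)) = fun i => val i x n := by
      intro n
      ext i
      rcases i with c | i | i <;> rfl
    simp only [hψ', e2]
    rw [Set.mem_ofPred_eq, e1]
    exact this
  have hSdef : (Set.univ : Set ((U : Filter ℕ).Product fun _ => K)).Definable₁ L S := by
    refine Set.definable_iff_exists_formula_sum.2 ⟨ψ.relabel (Sum.elim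
      (fun c : (Set.univ : Set K) => .inl ⟨ultraMk U fun _ => (c : K), Set.mem_univ _⟩)
      (Sum.elim (fun i => .inl ⟨ultraMk U fun n => w n i, Set.mem_univ _⟩) fun _ : Unit => .inr 0)), ?_⟩
    ext x
    rw [Set.mem_ofPred_eq, Set.mem_ofPred_eq, Set.mem_ofPred_eq, Formula.realize_relabel]
    refine iff_of_eq (congrArg ψ.Realize (funext fun i => ?_))
    rcases i with c | i | i <;> rfl
  have helem : L.ElementarilyEquivalent K ((U : Filter ℕ).Product fun _ => K) :=
    elementarilyEquivalent_iff.2 fun χ => by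
      rw [Ultraproduct.sentence_realize]
      exact eventually_const.symm
  have hmem := hC _ helem S hSdef
  have haS : ∀ j, ultraMk U (fun n => a n j) ∈ S := fun j =>
    (hS _).2 ((hU j).mono fun n hn => ha n j hn)
  have hbS : ∀ j, ultraMk U (fun n => b n j) ∉ S := fun j h => by
    obtain ⟨n, h1, h2⟩ := (((hS _).1 h).and (hU j)).exists
    exact hb n j h2 h1
  have key := eventually_mem_or_notMem_of_mem_closure (a := fun j => ultraMk U (fun n => a n j))
    (b := fun j => ultraMk U (fun n => b n j)) ?_ ?_ hmem
  · rcases key with h | h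
    · obtain ⟨j, hj⟩ := h.exists
      exact hbS j hj.2
    · obtain ⟨j, hj⟩ := h.exists
      exact hj.1 (haS j)
  · intro s hs i j hij hi hj k
    refine ⟨hφ.mem_of_isBall_ultrapower hs hi hj ?_, hφ.mem_of_isBall_ultrapower hs hi hj ?_⟩
    · filter_upwards [hU i, hU j, hU k] with n h1 h2 h3
      rw [haa n i h1 j h2 hij]
      rcases eq_or_ne k i with rfl | hk
      · simp
      · exact (haa n k h3 i h1 hk).ge
    · filter_upwards [hU i, hU j, hU k] with n h1 h2 h3
      rw [haa n i h1 j h2 hij, v.map_sub_swap]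
      exact hab n i h1 k h3
  · intro s hs i j hij hi hj k
    refine ⟨hφ.mem_of_isBall_ultrapower hs hi hj ?_, hφ.mem_of_isBall_ultrapower hs hi hj ?_⟩
    · filter_upwards [hU i, hU j, hU k] with n h1 h2 h3
      rw [hbb n i h1 j h2 hij]
      exact hab n k h3 i h1
    · filter_upwards [hU i, hU j, hU k] with n h1 h2 h3
      rw [hbb n i h1 j h2 hij]
      rcases eq_or_ne k i with rfl | hk
      · simp
      · exact (hbb n k h3 i h1 hk).ge

end Separation

/-! ### Behavior at infinity, roots, and infinitude of the residue field -/

section ResidueField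

variable {L : Language} {φ : Ldiv →ᴸ L} {K : Type u} {Γ : Type*} [Field K] [L.Structure K]
  [AddCommGroup Γ] [LinearOrder Γ] [IsOrderedAddMonoid Γ] {v : AddValuation K (WithTop Γ)}

theorem exists_coe_eq_val [Nontrivial Γ] (v : AddValuation K (WithTop Γ)) {x : K} (hx : x ≠ 0) :
    ∃ γ : Γ, v x = γ :=
  (WithTop.ne_top_iff_exists.1 (v.ne_top_iff.2 hx)).imp fun _ h => h.symm

/-- Every ball other than `K` itself misses a neighborhood of infinity, because `v (x - a) = v x` as
soon as `v x < v a`; the dichotomy passes to Boolean combinations. -/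
theorem ExpandsValuedField.eventually_mem_or_notMem [Nontrivial Γ] (hφ : ExpandsValuedField φ v)
    (hC : CMinimal φ K) {P : K → Prop} (hP : DefPred L fun z : Fin 1 → K => P (z 0)) :
    ∃ γ : Γ, (∀ x, v x < γ → P x) ∨ (∀ x, v x < γ → ¬ P x) := by
  have hmem := hC K rfl {x | P x} hP
  have hbd : ∀ x : K, ∃ γ : Γ, (γ : WithTop Γ) ≤ v x := by
    intro x
    by_cases hx : x = 0
    · exact ⟨0, by simp [hx]⟩
    · obtain ⟨γ, hγ⟩ := exists_coe_eq_val v hx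
      exact ⟨γ, hγ.ge⟩
  have hsub : ∀ x a : K, v x < v a → v (x - a) = v x := fun x a h =>
    v.map_sub_eq_of_lt_left h
  refine mem_boolean_closure_induction (Q := fun X => ∃ γ : Γ,
    (∀ x, v x < γ → x ∈ X) ∨ (∀ x, v x < γ → x ∉ X)) (fun s hs => ?_) ⟨0, .inr fun _ _ => id⟩
    ?_ ?_ hmem
  · cases hs with
    | closedBall a b =>
      obtain ⟨γ, hγ⟩ := hbd a
      obtain ⟨δ, hδ⟩ := hbd b
      refine ⟨min γ δ, .inr fun x hx h => ?_⟩
      rw [WithTop.coe_min, lt_min_iff] at hx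
      rw [Set.mem_ofPred_eq, hφ.neg, hφ.add, hφ.div, ← sub_eq_add_neg,
        hsub x a (hx.1.trans_le hγ)] at h
      exact absurd (hx.2.trans_le hδ) h.not_gt
    | openBall a b hb =>
      obtain ⟨γ, hγ⟩ := hbd a
      obtain ⟨δ, hδ⟩ := hbd b
      refine ⟨min γ δ, .inr fun x hx h => ?_⟩
      rw [WithTop.coe_min, lt_min_iff] at hx
      rw [Set.mem_ofPred_eq, hφ.neg, hφ.add, hφ.div, ← sub_eq_add_neg,
        hsub x a (hx.1.trans_le hγ)] at h
      exact h (hx.2.trans_le hδ).le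
    | univ => exact ⟨0, .inl fun _ _ => trivial⟩
  · rintro s ⟨γ, h | h⟩
    · exact ⟨γ, .inr fun x hx h' => h' (h x hx)⟩
    · exact ⟨γ, .inl h⟩
  · rintro s t ⟨γ, h | h⟩ ⟨δ, h' | h'⟩
    · exact ⟨γ, .inl fun x hx => .inl (h x hx)⟩
    · exact ⟨γ, .inl fun x hx => .inl (h x hx)⟩
    · exact ⟨δ, .inl fun x hx => .inr (h' x hx)⟩
    · refine ⟨min γ δ, .inr fun x hx => ?_⟩
      rw [WithTop.coe_min, lt_min_iff] at hx
      rintro (h1 | h1)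
      exacts [h x hx.1 h1, h' x hx.2 h1]

/-- A definable set with elements of arbitrarily small valuation contains all elements of
sufficiently small valuation. -/
theorem ExpandsValuedField.eventually_of_frequently [Nontrivial Γ] (hφ : ExpandsValuedField φ v)
    (hC : CMinimal φ K) {P : K → Prop} (hP : DefPred L fun z : Fin 1 → K => P (z 0))
    (h : ∀ γ : Γ, ∃ x, v x < γ ∧ P x) : ∃ γ : Γ, ∀ x, v x < γ → P x := by
  obtain ⟨γ, h' | h'⟩ := hφ.eventually_mem_or_notMem hC hP
  · exact ⟨γ, h'⟩
  · obtain ⟨x, hx, hP⟩ := h γ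
    exact absurd hP (h' x hx)

/-- The `n`-th powers have arbitrarily small valuation, so they fill a neighborhood of infinity;
multiplication by a suitable `t ^ n` moves any nonzero `x` there. -/
theorem ExpandsValuedField.exists_pow_eq [Nontrivial Γ] (hφ : ExpandsValuedField φ v)
    (hv : Function.Surjective v) (hC : CMinimal φ K) {n : ℕ} (hn : n ≠ 0) (x : K) :
    ∃ y, y ^ n = x := by
  have hsmall : ∀ γ : Γ, ∃ y : K, y ≠ 0 ∧ v (y ^ n) < γ := by
    intro γ
    obtain ⟨δ, hδ⟩ := exists_lt (min γ 0)
    rw [lt_min_iff] at hδ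
    obtain ⟨y, hy⟩ := hv δ
    refine ⟨y, v.ne_top_iff.1 (by simp [hy]), ?_⟩
    rw [v.map_pow, hy, ← WithTop.coe_nsmul, WithTop.coe_lt_coe]
    refine lt_of_le_of_lt ?_ hδ.1
    obtain ⟨m, rfl⟩ := Nat.exists_eq_succ_of_ne_zero hn
    rw [succ_nsmul]
    exact add_le_of_nonpos_left (nsmul_nonpos hδ.2.le m)
  obtain ⟨γ, hγ⟩ := hφ.eventually_of_frequently hC (P := fun x => ∃ y, y ^ n = x)
    (DefPred.exists (P := fun (z : Fin 1 → K) y => y ^ n = z 0)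
      (DefPred.eq (hφ.termFun_pow (TermFun.var (Sum.inr 0)) n) (TermFun.var (Sum.inl 0))))
    fun γ => (hsmall γ).elim fun y hy => ⟨y ^ n, hy.2, y, rfl⟩
  by_cases hx : x = 0
  · exact ⟨0, by simp [hx, hn]⟩
  obtain ⟨δ, hδ⟩ := exists_coe_eq_val v hx
  obtain ⟨t, ht, htn⟩ := hsmall (γ - δ)
  obtain ⟨y, hy⟩ := hγ (x * t ^ n) (by
    obtain ⟨ε, hε⟩ := exists_coe_eq_val v (pow_ne_zero n ht)
    rw [hε, WithTop.coe_lt_coe] at htn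
    rw [v.map_mul, hδ, hε, ← WithTop.coe_add, WithTop.coe_lt_coe]
    exact lt_sub_iff_add_lt'.1 htn)
  refine ⟨y / t, ?_⟩
  rw [div_pow, hy, mul_div_cancel_right₀ _ (pow_ne_zero n ht)]

/-- Outside characteristic 2 this is the quadratic formula with a square root of `-3`. In
characteristic 2 the additive map `y ↦ y ^ 2 + y` attains all values near infinity, in particular
some `b` and `b + 1`, hence also their sum `1`. -/
theorem ExpandsValuedField.exists_sq_add_self_add_one_eq_zero [Nontrivial Γ]
    (hφ : ExpandsValuedField φ v) (hv : Function.Surjective v) (hC : CMinimal φ K) :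
    ∃ z : K, z ^ 2 + z + 1 = 0 := by
  by_cases h2 : (2 : K) = 0
  · obtain ⟨γ, hγ⟩ := hφ.eventually_of_frequently hC (P := fun x => ∃ y, y ^ 2 + y = x)
      (DefPred.exists (P := fun (z : Fin 1 → K) y => y ^ 2 + y = z 0)
        (DefPred.eq (hφ.termFun_add (hφ.termFun_pow (TermFun.var (Sum.inr 0)) 2)
          (TermFun.var (Sum.inr 0))) (TermFun.var (Sum.inl 0)))) (by
      intro γ
      obtain ⟨δ, hδ⟩ := exists_lt (min γ 0)
      rw [lt_min_iff] at hδ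
      obtain ⟨y, hy⟩ := hv δ
      refine ⟨y ^ 2 + y, ?_, y, rfl⟩
      have h1 : δ + δ < δ := add_lt_of_neg_left δ hδ.2
      have : v (y ^ 2) = ((δ + δ : Γ) : WithTop Γ) := by
        rw [v.map_pow, hy, ← WithTop.coe_nsmul, two_nsmul]
      rw [v.map_add_eq_of_lt_left (by rw [this, hy, WithTop.coe_lt_coe]; exact h1), this,
        WithTop.coe_lt_coe]
      exact h1.trans hδ.1)
    obtain ⟨δ, hδ⟩ := exists_lt (min γ 0)
    rw [lt_min_iff] at hδ
    obtain ⟨b, hb⟩ := hv δ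
    obtain ⟨y, hy⟩ := hγ b (by rw [hb, WithTop.coe_lt_coe]; exact hδ.1)
    obtain ⟨y', hy'⟩ := hγ (b + 1) (by
      rw [v.map_add_eq_of_lt_left, hb, WithTop.coe_lt_coe]
      · exact hδ.1
      · rw [hb, v.map_one, ← WithTop.coe_zero, WithTop.coe_lt_coe]
        exact hδ.2)
    exact ⟨y + y', by linear_combination hy + hy' + (b + 1 + y * y') * h2⟩
  · obtain ⟨s, hs⟩ := hφ.exists_pow_eq hv hC two_ne_zero (-3)
    refine ⟨(s - 1) / 2, ?_⟩
    field_simp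
    linear_combination hs

/-- With a finite residue field of order `q`, every unit is a `(q - 1)`-th power and so has residue
`1`. A root `z` of `z ^ 2 + z + 1` contradicts this, since `z` and `z + 1` are both units. -/
theorem ExpandsValuedField.infinite_residueField [Nontrivial Γ]
    (hφ : ExpandsValuedField φ v) (hv : Function.Surjective v) (hC : CMinimal φ K) :
    ∃ u : ℕ → K, (∀ i, v (u i) = 0) ∧ ∀ i j, i ≠ j → v (u i - u j) = 0 := by
  let A := (AddValuation.toValuation v).valuationSubring
  have hA : ∀ x : K, x ∈ A ↔ 0 ≤ v x := fun x => Iff.rfl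
  have hres : ∀ a : A, IsLocalRing.residue A a ≠ 0 ↔ v (a : K) = 0 := by
    intro a
    rw [Ne, IsLocalRing.residue_eq_zero_iff, IsLocalRing.mem_maximalIdeal, mem_nonunits_iff,
      not_not, isUnit_iff_exists_inv]
    constructor
    · rintro ⟨b, hb⟩
      have : v (a : K) + v (b : K) = 0 := by
        rw [← v.map_mul, ← v.map_one]
        exact congrArg (fun x : A => v (x : K)) hb
      exact le_antisymm ((le_add_of_nonneg_right ((hA _).1 b.2)).trans this.le) ((hA _).1 a.2)
    · intro h
      have h0 : (a : K) ≠ 0 := v.ne_top_iff.1 (by simp [h])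
      have hinv : v (a : K)⁻¹ = 0 := by
        have : v ((a : K) * (a : K)⁻¹) = 0 := by rw [mul_inv_cancel₀ h0, v.map_one]
        rwa [v.map_mul, h, zero_add] at this
      exact ⟨⟨(a : K)⁻¹, (hA _).2 hinv.ge⟩, Subtype.ext (mul_inv_cancel₀ h0)⟩
  cases finite_or_infinite (IsLocalRing.ResidueField A) with
  | inr hinf =>
    have : Infinite {x : IsLocalRing.ResidueField A // x ≠ 0} :=
      (Set.finite_singleton 0).infinite_compl.to_subtype
    let e := Infinite.natEmbedding {x : IsLocalRing.ResidueField A // x ≠ 0}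
    choose u hu using fun i => IsLocalRing.residue_surjective (R := A) (e i).1
    refine ⟨fun i => u i, fun i => (hres _).1 (by rw [hu]; exact (e i).2), fun i j hij => ?_⟩
    have := (hres (u i - u j)).1 (by
      rw [map_sub, hu, hu, sub_ne_zero]
      exact fun h => hij (e.injective (Subtype.ext h)))
    exact this
  | inl hfin =>
    exfalso
    have := Fintype.ofFinite (IsLocalRing.ResidueField A)
    have hcard := Fintype.one_lt_card (α := IsLocalRing.ResidueField A)
    have key : ∀ a : K, v a = 0 → 0 < v (a - 1) := by
      intro a ha
      have hq : Fintype.card (IsLocalRing.ResidueField A) - 1 ≠ 0 := by omega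
      obtain ⟨y, hy⟩ := hφ.exists_pow_eq hv hC hq a
      have ha0 : a ≠ 0 := v.ne_top_iff.1 (by simp [ha])
      have hy0 : y ≠ 0 := by
        rintro rfl
        rw [zero_pow hq] at hy
        exact ha0 hy.symm
      obtain ⟨δ, hδ⟩ := exists_coe_eq_val v hy0
      have hvy : v y = 0 := by
        rw [← hy, v.map_pow, hδ, ← WithTop.coe_nsmul, ← WithTop.coe_zero, WithTop.coe_inj] at ha
        rw [hδ, (nsmul_eq_zero_iff.1 ha).resolve_right hq, WithTop.coe_zero]
      let y' : A := ⟨y, (hA _).2 hvy.ge⟩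
      have h1 := FiniteField.pow_card_sub_one_eq_one _ ((hres y').2 hvy)
      have h2 : IsLocalRing.residue A
          (y' ^ (Fintype.card (IsLocalRing.ResidueField A) - 1) - 1) = 0 := by
        rw [map_sub, map_pow, h1, map_one, sub_self]
      have h3 := mt (hres _).2 (not_not.2 h2)
      have h4 := (hA _).1 (y' ^ (Fintype.card (IsLocalRing.ResidueField A) - 1) - 1).2
      have h5 : ((y' ^ (Fintype.card (IsLocalRing.ResidueField A) - 1) - 1 : A) : K) = a - 1 := by
        rw [← hy]
        rfl
      rw [h5] at h3 h4
      exact lt_of_le_of_ne h4 (Ne.symm h3)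
    obtain ⟨z, hz⟩ := hφ.exists_sq_add_self_add_one_eq_zero hv hC
    -- The equation says `z * (z + 1) = -1`.
    have hmul : v z + v (z + 1) = 0 := by
      rw [← v.map_mul, ← v.map_one, ← v.map_neg 1]
      congr 1
      linear_combination hz
    have hz0 : 0 ≤ v z := by
      by_contra! h
      have h1 : v (z + 1) = v z := v.map_add_eq_of_lt_left (by rwa [v.map_one])
      rw [h1] at hmul
      exact absurd hmul ((add_le_of_nonpos_left h.le).trans_lt h).ne
    have hz1 : 0 ≤ v (z + 1) := v.map_le_add hz0 v.map_one.ge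
    have h1 : v z = 0 := le_antisymm ((le_add_of_nonneg_right hz1).trans hmul.le) hz0
    have h2 : v (z + 1) = 0 := by rwa [h1, zero_add] at hmul
    have := key _ h2
    rw [add_sub_cancel_right, h1] at this
    exact lt_irrefl _ this

end ResidueField

/-! ### Constancy of `v ∘ F` on the sets `v x = γ` near infinity -/

section Factorization

variable {L : Language} {φ : Ldiv →ᴸ L} {K : Type u} {Γ : Type*} [Field K] [L.Structure K]
  [AddCommGroup Γ] [LinearOrder Γ] [IsOrderedAddMonoid Γ] {v : AddValuation K (WithTop Γ)}

theorem val_inv_sub_inv [Nontrivial Γ] {x y : K} (hx : v x = 0) (hy : v y = 0)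
    (h : v (x - y) = 0) : v (x⁻¹ - y⁻¹) = 0 := by
  have hx0 : x ≠ 0 := v.ne_top_iff.1 (by simp [hx])
  have hy0 : y ≠ 0 := v.ne_top_iff.1 (by simp [hy])
  have : v (x * y * (x⁻¹ - y⁻¹)) = v (y - x) := by
    congr 1
    field_simp
  rwa [v.map_mul, v.map_mul, hx, hy, v.map_sub_swap y x, h, zero_add, zero_add] at this

theorem val_inv_eq_zero [Nontrivial Γ] {x : K} (hx : v x = 0) : v x⁻¹ = 0 := by
  have hx0 : x ≠ 0 := v.ne_top_iff.1 (by simp [hx])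
  have : v (x * x⁻¹) = 0 := by rw [mul_inv_cancel₀ hx0, v.map_one]
  rwa [v.map_mul, hx, zero_add] at this

theorem ExpandsValuedField.defPred_val_comp_lt (hφ : ExpandsValuedField φ v) {α : Type}
    {F : K → K} (hF : DefPred L fun z : Fin 2 → K => F (z 0) = z 1) {s t : (α → K) → K}
    (hs : TermFun L s) (ht : TermFun L t) : DefPred L fun z => v (F (s z)) < v (F (t z)) := by
  have hgraph : ∀ {β : Type} {p q : (β → K) → K}, TermFun L p → TermFun L q →
      DefPred L fun z => F (p z) = q z := fun {β p q} hp hq =>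
    hF.subst (g := ![p, q]) (by intro i; fin_cases i <;> assumption)
  refine DefPred.congr (P := fun z => ∃ a, ∃ b, (F (s z) = a ∧ F (t z) = b) ∧ v a < v b) ?_
    fun z => by simp
  refine DefPred.exists (P := fun z a => ∃ b, (F (s z) = a ∧ F (t z) = b) ∧ v a < v b)
    (DefPred.exists (P := fun (z : α ⊕ Fin 1 → K) b =>
      (F (s fun i => z (.inl i)) = z (.inr 0) ∧ F (t fun i => z (.inl i)) = b) ∧
        v (z (.inr 0)) < v b) ?_)
  refine DefPred.and (DefPred.and (hgraph ?_ ?_) (hgraph ?_ ?_)) (hφ.defPred_lt ?_ ?_)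
  · exact hs.subst fun i => TermFun.var (Sum.inl (Sum.inl i))
  · exact TermFun.var (Sum.inl (Sum.inr 0))
  · exact ht.subst fun i => TermFun.var (Sum.inl (Sum.inl i))
  · exact TermFun.var (Sum.inr 0)
  · exact TermFun.var (Sum.inl (Sum.inr 0))
  · exact TermFun.var (Sum.inr 0)

/-- The valuation of a definable function is, near infinity, constant on the sets `v x = γ`. -/
theorem ExpandsValuedField.exists_val_comp_eq [Nontrivial Γ] (hφ : ExpandsValuedField φ v)
    (hv : Function.Surjective v) (hC : CMinimal φ K) {F : K → K}
    (hF : DefPred L fun z : Fin 2 → K => F (z 0) = z 1) :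
    ∃ γ : Γ, ∀ x y, v x = v y → v x < γ → v (F x) = v (F y) := by
  obtain ⟨u, hu, huu⟩ := hφ.infinite_residueField hv hC
  have hu0 : ∀ i, u i ≠ 0 := fun i => v.ne_top_iff.1 (by simp [hu])
  obtain ⟨N, hN⟩ := hφ.exists_not_separates hC
    (hφ.defPred_val_comp_lt hF (TermFun.var (Sum.inl 0 : Fin 1 ⊕ Unit)) (TermFun.var (Sum.inr ())))
  -- Multiples of `x` and `y` by units with distinct residues are pairwise at distance exactly `v x`
  -- and lie in the closed ball of radius `v x` around `0`.
  have hsep : ∀ (x y : K) (s t : ℕ → K), v x = v y →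
      (∀ i, v (s i) = 0) → (∀ i j, i ≠ j → v (s i - s j) = 0) →
      (∀ i, v (t i) = 0) → (∀ i j, i ≠ j → v (t i - t j) = 0) → ∀ w : K,
      (∀ i < N, v (F w) < v (F (s i * x))) → ¬ ∀ i < N, ¬ v (F w) < v (F (t i * y)) := by
    intro x y s t hxy hs hss ht htt w h
    refine hN (fun _ => w) (v x) (fun i => s i * x) (fun i => t i * y) ?_ ?_ ?_ h
    · intro i _ j _ hij
      rw [← sub_mul, v.map_mul, hss i j hij, zero_add]
    · intro i _ j _ hij
      rw [← sub_mul, v.map_mul, htt i j hij, zero_add, hxy]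
    · intro i _ j _
      refine v.map_le_sub ?_ ?_
      · rw [v.map_mul, hs, zero_add]
      · rw [v.map_mul, ht, zero_add, hxy]
  -- The label `k` records the outcome near infinity: `0` for `v (F x) < v (F (u j * x))`, `1` for
  -- `>`, `2` for equality.
  have hlt : ∀ j, ∃ (γ : Γ) (k : Fin 3),
      (k = 0 → ∀ x, v x < γ → v (F x) < v (F (u j * x))) ∧
      (k = 1 → ∀ x, v x < γ → v (F (u j * x)) < v (F x)) ∧
      (k = 2 → ∀ x, v x < γ → v (F (u j * x)) = v (F x)) := by
    intro j
    have hmul : TermFun L fun z : Fin 1 → K => u j * z 0 :=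
      hφ.termFun_mul (TermFun.const _) (TermFun.var 0)
    obtain ⟨γ, h | h⟩ := hφ.eventually_mem_or_notMem hC
      (P := fun x => v (F x) < v (F (u j * x)))
      (hφ.defPred_val_comp_lt hF (TermFun.var 0) hmul)
    · exact ⟨γ, 0, fun _ => h, by simp, by simp⟩
    obtain ⟨δ, h' | h'⟩ := hφ.eventually_mem_or_notMem hC
      (P := fun x => v (F (u j * x)) < v (F x))
      (hφ.defPred_val_comp_lt hF hmul (TermFun.var 0))
    · exact ⟨δ, 1, by simp, fun _ => h', by simp⟩
    · refine ⟨min γ δ, 2, by simp, by simp, fun _ x hx => ?_⟩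
      rw [WithTop.coe_min, lt_min_iff] at hx
      exact le_antisymm (not_lt.1 (h x hx.1)) (not_lt.1 (h' x hx.2))
  choose γ k h0 h1 h2 using hlt
  obtain ⟨c, hc⟩ := Finite.exists_infinite_fiber k
  let e := Infinite.natEmbedding (k ⁻¹' {c})
  let σ : ℕ → ℕ := fun i => (e i : ℕ)
  have hσ : ∀ i j, i ≠ j → σ i ≠ σ j := fun i j hij h => hij (e.injective (Subtype.ext h))
  have hk : ∀ i, k (σ i) = c := fun i => (e i).2
  -- A common bound exists because only the first `N` indices matter; this is why `N` must not
  -- depend on the point `x`.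
  obtain ⟨γ₀, hγ₀⟩ := ((Set.finite_lt_nat N).image fun i => γ (σ i)).bddBelow
  have hγ : ∀ i < N, ∀ x : K, v x < γ₀ → v x < γ (σ i) := fun i hi x hx =>
    hx.trans_le (WithTop.coe_le_coe.2 (hγ₀ (Set.mem_image_of_mem _ hi)))
  have hu' : ∀ i, v (u i)⁻¹ = 0 := fun i => val_inv_eq_zero (hu i)
  have huu' : ∀ i j, i ≠ j → v ((u i)⁻¹ - (u j)⁻¹) = 0 := fun i j hij =>
    val_inv_sub_inv (hu i) (hu j) (huu i j hij)
  have hinv : ∀ i (x : K), v x < γ₀ → v ((u i)⁻¹ * x) < γ₀ := fun i x hx => by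
    rwa [v.map_mul, hu', zero_add]
  refine ⟨γ₀, fun x y hxy hx => ?_⟩
  have hc3 : c = 0 ∨ c = 1 ∨ c = 2 := by fin_cases c <;> simp
  rcases hc3 with rfl | rfl | rfl
  · refine absurd ?_ (hsep x x (fun i => u (σ i)) (fun i => (u (σ i))⁻¹) rfl (fun i => hu _)
      (fun i j hij => huu _ _ (hσ i j hij)) (fun i => hu' _)
      (fun i j hij => huu' _ _ (hσ i j hij)) x fun i hi => h0 _ (hk i) x (hγ i hi x hx))
    -- The comparison at `(u (σ i))⁻¹ * x`, whose multiple by `u (σ i)` is `x`, gives the reverse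
    -- inequality.
    intro i hi
    have := h0 _ (hk i) _ (hγ i hi _ (hinv (σ i) x hx))
    rw [mul_inv_cancel_left₀ (hu0 _)] at this
    exact this.not_gt
  · refine absurd ?_ (hsep x x (fun i => (u (σ i))⁻¹) (fun i => u (σ i)) rfl (fun i => hu' _)
      (fun i j hij => huu' _ _ (hσ i j hij)) (fun i => hu _)
      (fun i j hij => huu _ _ (hσ i j hij)) x ?_)
    · intro i hi
      exact (h1 _ (hk i) x (hγ i hi x hx)).not_gt
    · intro i hi
      have := h1 _ (hk i) _ (hγ i hi _ (hinv (σ i) x hx))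
      rwa [mul_inv_cancel_left₀ (hu0 _)] at this
  · have key : ∀ x y : K, v x = v y → v x < γ₀ → ¬ v (F x) < v (F y) := by
      intro x y hxy hx hlt
      refine absurd ?_ (hsep y x (fun i => u (σ i)) (fun i => u (σ i)) hxy.symm (fun i => hu _)
        (fun i j hij => huu _ _ (hσ i j hij)) (fun i => hu _)
        (fun i j hij => huu _ _ (hσ i j hij)) x ?_)
      · intro i hi
        rw [h2 _ (hk i) x (hγ i hi x hx)]
        exact lt_irrefl _
      · intro i hi
        rwa [h2 _ (hk i) y (hγ i hi y (hxy ▸ hx))]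
    exact le_antisymm (not_lt.1 (key y x hxy.symm (hxy ▸ hx))) (not_lt.1 (key x y hxy hx))

end Factorization

/-! ### Uniform definability of `h`, and families -/

section Families

variable {L : Language} {φ : Ldiv →ᴸ L} {K : Type u} {Γ : Type*} [Field K] [L.Structure K]
  [AddCommGroup Γ] [LinearOrder Γ] [IsOrderedAddMonoid Γ] {v : AddValuation K (WithTop Γ)}
  {n : ℕ}

open Classical in
/-- The extension by `1` of a function on a subset of `K^n × K`. -/
noncomputable def extendOne {X : Set ((Fin n → K) × K)} (f : X → Kˣ) (w : Fin n → K) (x : K) : Kˣ :=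
  if h : (w, x) ∈ X then f ⟨(w, x), h⟩ else 1

theorem defPred_extendOne {X : Set ((Fin n → K) × K)} {f : X → Kˣ}
    (hX : DefinableFamily L X) (hf : DefinableFamilyFun L fun p : X => (f p : K)) :
    DefPred L fun z : Fin n ⊕ Fin 2 → K =>
      (extendOne f (fun i => z (.inl i)) (z (.inr 0)) : K) = z (.inr 1) := by
  have hX' : DefPred L fun z : Fin n ⊕ Unit → K => (fun i => z (.inl i), z (.inr ())) ∈ X := hX
  have hf' : DefPred L fun z : Fin n ⊕ Fin 2 → K =>
    ∃ hz : (fun i => z (.inl i), z (.inr 0)) ∈ X, (f ⟨_, hz⟩ : K) = z (.inr 1) := hf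
  have hX2 : DefPred L fun z : Fin n ⊕ Fin 2 → K => (fun i => z (.inl i), z (.inr 0)) ∈ X :=
    hX'.reindex (Sum.elim Sum.inl fun _ => Sum.inr 0 : Fin n ⊕ Unit → Fin n ⊕ Fin 2)
  refine (hf'.or (hX2.not.and
    (DefPred.eq (TermFun.const 1) (TermFun.var (Sum.inr 1))))).congr fun z => ?_
  by_cases h : (fun i => z (.inl i), z (.inr 0)) ∈ X <;> simp [extendOne, h]

open Classical in
/-- The constant value of `v ∘ F` on the set `v x = γ`, and `0` if there is none. -/
noncomputable def sphereValue (v : AddValuation K (WithTop Γ)) (F : K → Kˣ) (γ : Γ) : Γ :=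
  if h : ∃ δ : Γ, ∀ x, v x = γ → v (F x) = δ then h.choose else 0

/-- This removes the choice, leaving a condition that can be expressed in `L`. Surjectivity of `v`
makes the set `v x = γ` nonempty, so the constant is unique. -/
theorem sphereValue_eq_iff (hv : Function.Surjective v) (F : K → Kˣ) (γ δ : Γ) :
    sphereValue v F γ = δ ↔ (∀ x, v x = γ → v (F x) = δ) ∨
      (¬ ∃ ε : Γ, ∀ x, v x = γ → v (F x) = ε) ∧ δ = 0 := by
  unfold sphereValue
  split_ifs with h
  · obtain ⟨x, hx⟩ := hv γ
    have h1 := h.choose_spec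
    constructor
    · rintro rfl
      exact .inl h1
    · rintro (h2 | h2)
      · rw [← WithTop.coe_inj, ← h1 x hx, h2 x hx]
      · exact absurd h h2.1
  · constructor
    · rintro rfl
      exact .inr ⟨h, rfl⟩
    · rintro (h2 | h2)
      · exact absurd ⟨δ, h2⟩ h
      · exact h2.2.symm

theorem ExpandsValuedField.gammaDefinable_sphereValue [Nontrivial Γ]
    (hφ : ExpandsValuedField φ v) (hv : Function.Surjective v) {F : (Fin n → K) → K → Kˣ}
    (hF : DefPred L fun z : Fin n ⊕ Fin 2 → K =>
      (F (fun i => z (.inl i)) (z (.inr 0)) : K) = z (.inr 1))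
    {W : Set (Fin n → K)} (hW : (Set.univ : Set K).Definable L W) :
    GammaDefinable L v {p : (Fin n → K) × (Fin 2 → Γ) |
      p.1 ∈ W ∧ sphereValue v (F p.1) (p.2 0) = p.2 1} := by
  have hW' : DefPred L fun z : Fin n → K => z ∈ W := hW
  have hconst : DefPred L fun z : Fin n ⊕ Fin 2 → K => ∀ x, v x = v (z (.inr 0)) →
      v (F (fun i => z (.inl i)) x) = v (z (.inr 1)) := by
    refine DefPred.forall (P := fun (z : Fin n ⊕ Fin 2 → K) x => v x = v (z (.inr 0)) →
      v (F (fun i => z (.inl i)) x) = v (z (.inr 1)))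
      ((hφ.defPred_val_eq (TermFun.var (Sum.inr 0)) (TermFun.var (Sum.inl (Sum.inr 0)))).imp ?_)
    -- `F` is only known through its graph, so its value has to be named by a quantified variable.
    refine DefPred.congr (P := fun z : (Fin n ⊕ Fin 2) ⊕ Fin 1 → K => ∃ y,
      (F (fun i => z (.inl (.inl i))) (z (.inr 0)) : K) = y ∧ v y = v (z (.inl (.inr 1)))) ?_
      fun z => by simp
    refine DefPred.exists (P := fun (z : (Fin n ⊕ Fin 2) ⊕ Fin 1 → K) y =>
      (F (fun i => z (.inl (.inl i))) (z (.inr 0)) : K) = y ∧ v y = v (z (.inl (.inr 1))))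
      (DefPred.and ?_ (hφ.defPred_val_eq (TermFun.var (Sum.inr 0))
        (TermFun.var (Sum.inl (Sum.inl (Sum.inr 1))))))
    exact hF.reindex (Sum.elim (fun i => .inl (.inl (.inl i)))
      ![.inl (.inr 0), .inr 0] : Fin n ⊕ Fin 2 → ((Fin n ⊕ Fin 2) ⊕ Fin 1) ⊕ Fin 1)
  have hex : DefPred L fun z : Fin n ⊕ Fin 2 → K => ∃ d, d ≠ 0 ∧ ∀ x, v x = v (z (.inr 0)) →
      v (F (fun i => z (.inl i)) x) = v d :=
    DefPred.exists (P := fun (z : Fin n ⊕ Fin 2 → K) d => d ≠ 0 ∧ ∀ x, v x = v (z (.inr 0)) →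
      v (F (fun i => z (.inl i)) x) = v d)
      ((DefPred.eq (TermFun.var (Sum.inr 0)) (TermFun.const 0)).not.and
        (hconst.reindex (Sum.elim (fun i => .inl (.inl i))
          ![.inl (.inr 0), .inr 0] : Fin n ⊕ Fin 2 → (Fin n ⊕ Fin 2) ⊕ Fin 1)))
  have hne : ∀ i : Fin 2, DefPred L fun z : Fin n ⊕ Fin 2 → K => z (.inr i) ≠ 0 := fun i =>
    (DefPred.eq (TermFun.var (Sum.inr i)) (TermFun.const 0)).not
  -- Elements of `Γ` are coded by nonzero elements of `K`; the default value `0` of `sphereValue` is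
  -- coded by `v 1`.
  refine DefPred.congr (((hne 0).and (hne 1)).and ((hW'.reindex
    (Sum.inl : Fin n → Fin n ⊕ Fin 2)).and (hconst.or (hex.not.and (hφ.defPred_val_eq
      (TermFun.var (Sum.inr 1)) (TermFun.const 1)))))) fun z => ?_
  by_cases hz : z (.inr 0) ≠ 0 ∧ z (.inr 1) ≠ 0
  · obtain ⟨γ, hγ⟩ := exists_coe_eq_val v hz.1
    obtain ⟨δ, hδ⟩ := exists_coe_eq_val v hz.2
    have hd : (∃ d, d ≠ 0 ∧ ∀ x, v x = γ → v (F (fun i => z (.inl i)) x) = v d) ↔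
        ∃ ε : Γ, ∀ x, v x = γ → v (F (fun i => z (.inl i)) x) = ε := by
      constructor
      · rintro ⟨d, hd, h⟩
        obtain ⟨ε, hε⟩ := exists_coe_eq_val v hd
        exact ⟨ε, by rwa [hε] at h⟩
      · rintro ⟨ε, h⟩
        obtain ⟨d, hd⟩ := hv ε
        exact ⟨d, v.ne_top_iff.1 (by simp [hd]), by rwa [hd]⟩
    have hg : ∀ g : Fin 2 → Γ, (∀ i, v (z (.inr i)) = g i) ↔ g = ![γ, δ] := by
      intro g
      constructor
      · intro h
        ext i
        have := h i
        fin_cases i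
        · exact WithTop.coe_inj.1 (this.symm.trans hγ)
        · exact WithTop.coe_inj.1 (this.symm.trans hδ)
      · rintro rfl i
        fin_cases i
        exacts [hγ, hδ]
    simp only [hg, exists_eq_left, Set.mem_ofPred_eq, Matrix.cons_val_zero, Matrix.cons_val_one,
      sphereValue_eq_iff hv, hγ, hδ, hd, v.map_one, hz, WithTop.coe_eq_zero, ne_eq,
      not_false_eq_true, true_and]
  · refine iff_of_false ?_ fun h => hz h.1
    rintro ⟨g, hg, -⟩
    exact hz ⟨v.ne_top_iff.1 (by simp [hg]), v.ne_top_iff.1 (by simp [hg])⟩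

theorem ExpandsValuedField.exists_factorization [Nontrivial Γ] (hφ : ExpandsValuedField φ v)
    (hv : Function.Surjective v) (hC : CMinimal φ K) {W : Set (Fin n → K)}
    {X : Set ((Fin n → K) × K)} (f : X → Kˣ) (hW : (Set.univ : Set K).Definable L W)
    (hX : DefinableFamily L X) (hf : DefinableFamilyFun L fun p : X => (f p : K)) :
    ∃ h : W → Γ → Γ,
      GammaDefinable L v {p : (Fin n → K) × (Fin 2 → Γ) |
        ∃ hw : p.1 ∈ W, h ⟨p.1, hw⟩ (p.2 0) = p.2 1} ∧
      ∀ w : W, FactorizesAtInftyThrough v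
        (fiberFun (fun p : X => (f p : K)) (w : Fin n → K)) (h w) := by
  have hF := defPred_extendOne hX hf
  refine ⟨fun w => sphereValue v (extendOne f w), ?_, fun w => ?_⟩
  · simpa only [exists_prop] using hφ.gammaDefinable_sphereValue hv hF hW
  obtain ⟨γ₀, hγ₀⟩ := hφ.exists_val_comp_eq hv hC (F := fun x => (extendOne f w x : K))
    (hF.subst (g := Sum.elim (fun i _ => (w : Fin n → K) i) fun i z => z i)
      (by
        rintro (i | i)
        exacts [TermFun.const _, TermFun.var _]))
  refine ⟨γ₀, fun x hx => ?_⟩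
  have hx' : v (x : K) < γ₀ := by
    rw [ball, Set.mem_ofPred_eq, sub_zero, not_le] at hx
    exact hx
  obtain ⟨γ, hγ⟩ := WithTop.ne_top_iff_exists.1 (hx'.trans_le le_top).ne
  have hfx : fiberFun (fun p : X => (f p : K)) (w : Fin n → K) x = extendOne f w x := by
    have : ((w : Fin n → K), (x : K)) ∈ X := x.2
    simp [fiberFun, extendOne, this]
  obtain ⟨δ, hδ⟩ := exists_coe_eq_val v (extendOne f w x).ne_zero
  rw [hfx, ← hγ, WithTop.map_coe, hδ, WithTop.coe_inj, eq_comm, sphereValue_eq_iff hv]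
  refine .inl fun y hy => ?_
  rw [← hδ]
  exact hγ₀ y x (hy.trans hγ) (by rwa [hy, hγ])

end Families

end CMin

theorem mainTheorem4 {L : FirstOrder.Language} (φ : CMin.Ldiv →ᴸ L)
    {K Γ : Type*} [Field K] [L.Structure K]
    [AddCommGroup Γ] [LinearOrder Γ] [IsOrderedAddMonoid Γ] [Nontrivial Γ]
    (v : AddValuation K (WithTop Γ)) (hv : Function.Surjective v)
    (hφ : CMin.ExpandsValuedField φ v) (hC : CMin.CMinimal φ K) :
    (∀ (X : Set K) (f : X → Kˣ),
      (Set.univ : Set K).Definable₁ L X →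
      (Set.univ : Set K).Definable₂ L
        {p : K × K | ∃ hx : p.1 ∈ X, (f ⟨p.1, hx⟩ : K) = p.2} →
      CMin.ContainsNhdInfty v X →
      ∃ h : Γ → Γ,
        CMin.GammaDefinable L v
          {p : (Fin 0 → K) × (Fin 2 → Γ) | h (p.2 0) = p.2 1} ∧
        CMin.FactorizesAtInftyThrough v (fun x : X => (f x : K)) h) ∧
    (∀ (n : ℕ) (W : Set (Fin n → K)) (X : Set ((Fin n → K) × K)) (f : X → Kˣ),
      (Set.univ : Set K).Definable L W →
      CMin.DefinableFamily L X →
      Prod.fst '' X = W →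
      CMin.DefinableFamilyFun L (fun p : X => (f p : K)) →
      (∀ w ∈ W, CMin.ContainsNhdInfty v (CMin.fiber X w)) →
      ∃ h : W → Γ → Γ,
        CMin.GammaDefinable L v
          {p : (Fin n → K) × (Fin 2 → Γ) | ∃ hw : p.1 ∈ W, h ⟨p.1, hw⟩ (p.2 0) = p.2 1} ∧
        ∀ w : W, CMin.FactorizesAtInftyThrough v
          (CMin.fiberFun (fun p : X => (f p : K)) (w : Fin n → K)) (h w)) := by
  refine ⟨fun X f hX hf _ => ?_, fun n W X f hW hX _ hf _ =>
    hφ.exists_factorization hv hC f hW hX hf⟩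
  have hX' : CMin.DefPred L fun z : Fin 1 → K => z 0 ∈ X := hX
  have hf' : CMin.DefPred L fun z : Fin 2 → K => ∃ hx : z 0 ∈ X, (f ⟨z 0, hx⟩ : K) = z 1 := hf
  -- A single function is a family over the one-point space `K ^ 0`.
  obtain ⟨h, hdef, hfac⟩ := hφ.exists_factorization hv hC (n := 0) (W := Set.univ)
    (X := {p | p.2 ∈ X}) (fun p => f ⟨p.1.2, p.2⟩) Set.definable_univ
    (hX'.reindex fun _ => Sum.inr ()) (hf'.reindex Sum.inr)
  refine ⟨h ⟨default, trivial⟩, ?_, ?_⟩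
  · convert hdef using 1
    ext p
    have hp : p.1 = default := Subsingleton.elim _ _
    simp [hp]
  · obtain ⟨γ₀, hγ₀⟩ := hfac ⟨default, trivial⟩
    exact ⟨γ₀, fun x hx => hγ₀ ⟨x, x.2⟩ hx⟩
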